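/- **Setting.** Let $\Omega$ be a measurable space with a countable family of measurable sets separating its points (for instance a standard Borel space), $G_0$ a finite nonzero measure on $\Omega$ giving mass $0$ to every point, $\gamma_0=G_0(\Omega)$, and $\rho$ a measure on $(0,\infty)$ with $\rho\neq 0$ and $\int_0^\infty\min\{1,r\}\,\rho(dr)<\infty$. Let $G=\sum_k r_k\delta_{\omega_k}$ (at most countably many atoms, a.s. distinct, $r_k>0$) be a completely random measure on $\Omega$ with Lévy measure $\rho(dr)G_0(d\omega)$: a.s. $G(\Omega)<\infty$, the masses of disjoint measurable sets are independent, and $\mathbb E[e^{iuG(A)}]=\exp\big(\int\!\int_{(0,\infty)\times A}(e^{iur}-1)\rho(dr)G_0(d\omega)\big)$. In the count-mixture model, given $G$, the sample size $M$ is Poisson with mean $G(\Omega)$, and given $G$ and $M=m$ the cluster indicators of the $m$ elements are i.i.d. with law $\sum_k \frac{r_k}{G(\Omega)}\delta_k$. The ties between the indicators partition the sample into clusters. Write $f_M(m)=P(M=m)$. Let $\boldsymbol z=(z_1,\dots,z_j)$ be labels that encode a partition of the first $j$ elements, and let $m'\ge j$. Then $f(\boldsymbol z,m')$ denotes the joint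 probability that $M=m'$ and that the first $j$ elements are partitioned as in $\boldsymbol z$ (for $j=m'$ this is the ECPF), and $f(\boldsymbol z\mid m')$ denotes the conditional probability, given $M=m'$, that the first $j$ elements are partitioned as in $\boldsymbol z$ (for $j=m'$ this is the EPPF). For $n\ge 1$ put $\kappa_n=\int_0^\infty r^n e^{-r}\rho(dr)$. **Corollary (Size-Dependent EPPF).** Let $m\ge 0$ and let $\boldsymbol z=(z_1,\dots,z_m)$ have exactly $l$ clusters, labelled $1,\dots,l$, with sizes $n_1,\dots,n_l\geq 1$. Then $\kappa_n>0$ for every $n\ge1$, and $f_M(m)$, $f_M(m+1)$, $f(\boldsymbol z,m+1)$ are positive. In a sample of size $m+1$, the probability function of $\boldsymbol z$ is $$f(\boldsymbol z\mid m+1)=f(\boldsymbol z\mid m)\,\frac{f_M(m)}{(m+1)\,f_M(m+1)}\Big(\gamma_0\kappa_1+\sum_{k=1}^{l}\frac{\kappa_{n_k+1}}{\kappa_{n_k}}\Big).$$ Given $M=m+1$ and the partition $\boldsymbol z$ of the first $m$ elements, the new element is clustered with the prediction rule $$f(z_{m+1}=k\mid\boldsymbol z,m+1)=\frac{f(\boldsymbol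 z,z_{m+1}=k,m+1)}{f(\boldsymbol z,m+1)},\qquad k=1,\dots,l+1,$$ where $k\le l$ means joining cluster $k$ and $k=l+1$ means opening a new cluster. This probability equals $w_k/\sum_{k'=1}^{l+1}w_{k'}$ with $w_k=\kappa_{n_k+1}/\kappa_{n_k}$ for $k\le l$ and $w_{l+1}=\gamma_0\kappa_1$. -/

import Mathlib

open MeasureTheory ProbabilityTheory Set
open scoped NNReal ENNReal

noncomputable section

namespace CountMixture

variable {S Ω : Type*} [MeasurableSpace S] [MeasurableSpace Ω]

/-- A completely random measure `G` on `Ω` with almost surely finite total mass and Lévy measure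
`ν` on `ℝ₊ × Ω`: the masses of disjoint measurable sets are independent, and
`E[exp (i u G(A))] = exp (∫∫_{ℝ₊ × A} (exp (i u r) - 1) ν(dr dω))`. -/
structure IsCompletelyRandomMeasure (P : Measure S) (G : S → Measure Ω) (ν : Measure (ℝ × Ω)) :
    Prop where
  measurable : Measurable G
  finite : ∀ᵐ s ∂P, G s univ < ∞
  indep : ∀ (n : ℕ) (A : Fin n → Set Ω), (∀ i, MeasurableSet (A i)) →
    Pairwise (fun i j => Disjoint (A i) (A j)) → iIndepFun (fun i s => G s (A i)) P
  charFun_eq : ∀ A : Set Ω, MeasurableSet A → ∀ u : ℝ,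
    ∫ s, Complex.exp (Complex.I * (u : ℂ) * (((G s A).toReal : ℝ) : ℂ)) ∂P =
      Complex.exp (∫ x in univ ×ˢ A, (Complex.exp (Complex.I * (u : ℂ) * (x.1 : ℂ)) - 1) ∂ν)

/-- The homogeneous Lévy measure `ν(dr dω) = ρ(dr) G₀(dω)`. Only the restriction of `ρ` to
`(0, ∞)` plays a role. -/
def levyMeasure (ρ : Measure ℝ) (G₀ : Measure Ω) : Measure (ℝ × Ω) :=
  (ρ.restrict (Ioi 0)).prod G₀

/-- The random measure `G = ∑ₖ rₖ δ_{ωₖ}`. Indices with `rₖ = 0` carry no atom, so the number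
`K ≤ ∞` of atoms may be finite and random. -/
def atomicMeasure (r : ℕ → S → ℝ≥0) (loc : ℕ → S → Ω) (s : S) : Measure Ω :=
  Measure.sum fun k => (r k s : ℝ≥0∞) • Measure.dirac (loc k s)

/-- The count-mixture model: `G = ∑ₖ rₖ δ_{ωₖ}` is a completely random measure, with distinct atoms
`ωₖ` and Lévy measure `ρ(dr) G₀(dω)`; given `G`, the sample size `M` is Poisson with mean `G(Ω)`;
and given `G` and `M = m`, the cluster indicators `Z₀, …, Z_{m-1}` are independent with law
`∑ₖ (rₖ / G(Ω)) δₖ`. The indicators `Zᵢ` with `i ≥ M` are not part of the sample and are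
unconstrained. -/
structure IsCountMixture (P : Measure S) (ρ : Measure ℝ) (G₀ : Measure Ω)
    (r : ℕ → S → ℝ≥0) (loc : ℕ → S → Ω) (M : S → ℕ) (Z : ℕ → S → ℕ) : Prop where
  measurable_weight : ∀ k, Measurable (r k)
  measurable_loc : ∀ k, Measurable (loc k)
  measurable_size : Measurable M
  measurable_indicator : ∀ i, Measurable (Z i)
  distinct_atoms : ∀ᵐ s ∂P, ∀ j k, r j s ≠ 0 → r k s ≠ 0 → loc j s = loc k s → j = k
  crm : IsCompletelyRandomMeasure P (atomicMeasure r loc) (levyMeasure ρ G₀)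
  sample : ∀ (m : ℕ) (z : Fin m → ℕ),
    P[indicator {s | M s = m ∧ ∀ i : Fin m, Z i s = z i} (fun _ => (1 : ℝ)) |
        MeasurableSpace.comap (fun s (k : ℕ) => (r k s, loc k s)) inferInstance] =ᵐ[P]
      fun s => (poissonMeasure (atomicMeasure r loc s univ).toNNReal).real {m} *
        ∏ i, (r (z i) s : ℝ) / (atomicMeasure r loc s univ).toReal

/-- Two sequences of labels define the same partition of the index set: the ties agree. -/
def SameTies {j : ℕ} {α β : Type*} (x : Fin j → α) (z : Fin j → β) : Prop :=
  ∀ a b, x a = x b ↔ z a = z b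

/-- The event that the ties between the first `j` cluster indicators are those of `z`. -/
def tiesEvent (Z : ℕ → S → ℕ) {j : ℕ} {α : Type*} (z : Fin j → α) : Set S :=
  {s | SameTies (fun i : Fin j => Z i s) z}

/-- `f_M(m)`, the probability mass function of the sample size. -/
def sizePMF (P : Measure S) (M : S → ℕ) (m : ℕ) : ℝ := P.real {s | M s = m}

/-- `f(z_{1:j}, m)`, for `j ≤ m`: the joint probability of sample size `m` and of the partition of
the first `j` elements given by `z`. For `j = m` this is the exchangeable cluster probability
function. -/
def ecpf (P : Measure S) (M : S → ℕ) (Z : ℕ → S → ℕ) (m : ℕ) {j : ℕ} {α : Type*}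
    (z : Fin j → α) : ℝ :=
  P.real ({s | M s = m} ∩ tiesEvent Z z)

/-- `f(z_{1:j} | m)`, for `j ≤ m`: the conditional probability, given sample size `m`, of the
partition of the first `j` elements given by `z`. For `j = m` this is the exchangeable partition
probability function, for `j < m` the size-dependent one. -/
def eppf (P : Measure S) (M : S → ℕ) (Z : ℕ → S → ℕ) (m : ℕ) {j : ℕ} {α : Type*}
    (z : Fin j → α) : ℝ :=
  (cond P {s | M s = m}).real (tiesEvent Z z)

/-- The labels `(z₁, …, z_m, k)` after one more element has been added: `k : Fin (l + 1)` is one of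
the `l` old clusters, or `Fin.last l` for a new cluster. -/
def addElement {m l : ℕ} (z : Fin m → Fin l) (k : Fin (l + 1)) : Fin (m + 1) → Fin (l + 1) :=
  Fin.snoc (α := fun _ => Fin (l + 1)) (fun i => (z i).castSucc) k

/-- `f(z_{m+1} = k | z, m + 1)`: given that the sample size is `m + 1` and that the first `m`
elements are clustered as in `z`, the conditional probability that the last one joins `k`. -/
def predictive (P : Measure S) (M : S → ℕ) (Z : ℕ → S → ℕ) {m l : ℕ}
    (z : Fin m → Fin l) (k : Fin (l + 1)) : ℝ :=
  (cond P ({s | M s = m + 1} ∩ tiesEvent Z z)).real (tiesEvent Z (addElement z k))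

/-- `n_k`, the number of elements in cluster `k`. -/
def clusterSize {m l : ℕ} (z : Fin m → Fin l) (k : Fin l) : ℕ :=
  (Finset.univ.filter fun i => z i = k).card

/-- `∫₀^∞ rⁿ e^{-r} ρ(dr)`. -/
def kappa (ρ : Measure ℝ) (n : ℕ) : ℝ := ∫ r in Ioi (0 : ℝ), r ^ n * Real.exp (-r) ∂ρ

/-- The unnormalized weight of each possible label of a new element: `κ(n_k + 1) / κ(n_k)` for an
old cluster `k`, and `γ₀ κ(1)` for a new cluster. -/
def predictionWeight (γ₀ : ℝ) (ρ : Measure ℝ) {m l : ℕ} (z : Fin m → Fin l) : Fin (l + 1) → ℝ :=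
  Fin.snoc (α := fun _ => ℝ)
    (fun k => kappa ρ (clusterSize z k + 1) / kappa ρ (clusterSize z k)) (γ₀ * kappa ρ 1)

end CountMixture

end

open CountMixture

/-!
Let `X = G(A)` and `a = G₀(A)`. On the imaginary axis `E[exp (w X)] = exp (a φ(w))`, where
`φ(w) = ∫ (exp (w r) - 1) ρ(dr)`. Both sides are holomorphic on the left half-plane and continuous
up to its boundary, so they agree there by Phragmén–Lindelöf. As `φ⁽ⁿ⁾(-1) = κₙ`, Cauchy estimates
at `-1` give `E[Xⁿ e^{-X}] / E[e^{-X}] = a κₙ + O(a²)` for `n ≥ 1`.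

Given `G`, the probability that `M = m` and that the `m` elements have their atoms in prescribed
cells of a finite partition of `Ω` is `e^{-G(Ω)} / m!` times the product of the masses of these
cells. Independence over disjoint cells turns its mean into a product of tilted moments. Refine the
partition so that it separates the points of `Ω`: the masses of the cells tend to `0`, so the
errors `O(a²)` vanish after summation over the cells of the `l` clusters, while the products of
masses of distinct cells sum to `γ₀ˡ` in the limit. Hence
`f(z, m) = E[e^{-G(Ω)}] / m! * ∏ₖ γ₀ κ(nₖ)`, and the claims are ratios of such products.
-/

namespace CountMixture

open Filter Topology

noncomputable section

section LevyExponent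

lemma norm_exp_sub_one_le_norm_of_re_nonpos {w : ℂ} (hw : w.re ≤ 0) :
    ‖Complex.exp w - 1‖ ≤ ‖w‖ := by
  simpa using (convex_halfSpace_re_le (0 : ℝ)).norm_image_sub_le_of_norm_deriv_le
    (f := Complex.exp) (C := 1) (x := 0) (y := w)
    (fun x _ => Complex.differentiableAt_exp)
    (fun x hx => by simpa [Complex.norm_exp] using hx) (by simp) hw

lemma norm_exp_mul_le_one {w : ℂ} (hw : w.re ≤ 0) {x : ℝ} (hx : 0 ≤ x) :
    ‖Complex.exp (w * x)‖ ≤ 1 := by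
  rw [Complex.norm_exp, Complex.re_mul_ofReal]
  exact Real.exp_le_one_iff.2 (mul_nonpos_of_nonpos_of_nonneg hw hx)

lemma norm_exp_mul_sub_one_le {w : ℂ} (hw : w.re ≤ 0) {r : ℝ} (hr : 0 ≤ r) :
    ‖Complex.exp (w * r) - 1‖ ≤ max 2 ‖w‖ * min 1 r := by
  rcases le_total 1 r with h1r | hr1
  · calc ‖Complex.exp (w * r) - 1‖ ≤ ‖Complex.exp (w * r)‖ + ‖(1 : ℂ)‖ := norm_sub_le _ _
      _ ≤ 1 + 1 := add_le_add (norm_exp_mul_le_one hw hr) norm_one.le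
      _ ≤ max 2 ‖w‖ * min 1 r := by
        rw [min_eq_left h1r, mul_one, one_add_one_eq_two]; exact le_max_left _ _
  · have hre : (w * r).re ≤ 0 := by
      rw [Complex.re_mul_ofReal]; exact mul_nonpos_of_nonpos_of_nonneg hw hr
    calc ‖Complex.exp (w * r) - 1‖ ≤ ‖w * r‖ := norm_exp_sub_one_le_norm_of_re_nonpos hre
      _ = ‖w‖ * r := by rw [norm_mul, Complex.norm_real, Real.norm_of_nonneg hr]
      _ ≤ max 2 ‖w‖ * min 1 r := by rw [min_eq_right hr1]; gcongr; exact le_max_right _ _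

lemma mul_exp_mul_le {t r : ℝ} (ht : t < 0) (hr : 0 ≤ r) :
    r * Real.exp (t * r) ≤ max 1 (-t)⁻¹ * min 1 r := by
  have ht' : 0 < -t := neg_pos.2 ht
  rcases le_total 1 r with h1r | hr1
  · rw [min_eq_left h1r, mul_one]
    refine le_trans ?_ (le_max_right _ _)
    rw [← neg_neg t, neg_mul, neg_neg, Real.exp_neg, ← div_eq_mul_inv, div_le_iff₀ (Real.exp_pos _),
      ← div_eq_inv_mul, le_div_iff₀ ht']
    linarith [Real.add_one_le_exp (-t * r)]
  · rw [min_eq_right hr1, mul_comm]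
    have hexp : Real.exp (t * r) ≤ 1 :=
      Real.exp_le_one_iff.2 (mul_nonpos_of_nonpos_of_nonneg ht.le hr)
    gcongr
    exact hexp.trans (le_max_left _ _)

lemma setOf_re_neg_mem_nhds {w : ℂ} (hw : w.re < 0) : {z : ℂ | z.re < 0} ∈ 𝓝 w :=
  (isOpen_lt Complex.continuous_re continuous_const).mem_nhds hw

/-- The Lévy exponent `w ↦ ∫₀^∞ (e^{wr} - 1) ρ(dr)`: the subordinator with Lévy measure `ρ` on
`(0, ∞)` and no drift has moment generating function `exp (t * levyExponent ρ w)` at time `t`. -/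
def levyExponent (ρ : Measure ℝ) (w : ℂ) : ℂ :=
  ∫ r in Ioi (0 : ℝ), (Complex.exp (w * r) - 1) ∂ρ

/-- The size-biased measure `r ρ(dr)` on `(0, ∞)`: its moment generating function is the derivative
of the Lévy exponent. -/
def sizeBiased (ρ : Measure ℝ) : Measure ℝ :=
  (ρ.restrict (Ioi 0)).withDensity fun r => (r.toNNReal : ℝ≥0∞)

variable {ρ : Measure ℝ}

lemma integral_sizeBiased {E : Type*} [NormedAddCommGroup E] [NormedSpace ℝ E] (g : ℝ → E) :
    ∫ r, g r ∂sizeBiased ρ = ∫ r in Ioi (0 : ℝ), r • g r ∂ρ := by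
  rw [sizeBiased, integral_withDensity_eq_integral_smul measurable_real_toNNReal]
  refine setIntegral_congr_fun measurableSet_Ioi fun r hr => ?_
  rw [NNReal.smul_def, Real.coe_toNNReal r (le_of_lt hr)]

lemma integrable_sizeBiased_iff {E : Type*} [NormedAddCommGroup E] [NormedSpace ℝ E] {g : ℝ → E} :
    Integrable g (sizeBiased ρ) ↔ IntegrableOn (fun r => r • g r) (Ioi 0) ρ := by
  rw [sizeBiased, integrable_withDensity_iff_integrable_smul measurable_real_toNNReal]
  refine integrableOn_congr_fun (fun r hr => ?_) measurableSet_Ioi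
  rw [NNReal.smul_def, Real.coe_toNNReal r (le_of_lt hr)]

lemma integrableOn_min_one_of_lintegral_lt_top
    (hρ : ∫⁻ r in Ioi (0 : ℝ), ENNReal.ofReal (min 1 r) ∂ρ < ∞) :
    IntegrableOn (fun r => min 1 r) (Ioi 0) ρ := by
  refine ⟨by fun_prop, (hasFiniteIntegral_iff_ofReal ?_).2 hρ⟩
  filter_upwards [ae_restrict_mem measurableSet_Ioi] with r hr using (lt_min one_pos hr).le

lemma kappa_nonneg (ρ : Measure ℝ) (n : ℕ) : 0 ≤ kappa ρ n :=
  setIntegral_nonneg measurableSet_Ioi fun _ hr =>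
    mul_nonneg (pow_nonneg (le_of_lt hr) n) (Real.exp_pos _).le

variable (hρ : IntegrableOn (fun r => min 1 r) (Ioi 0) ρ)
include hρ

lemma sFinite_restrict_Ioi : SFinite (ρ.restrict (Ioi 0)) := by
  have hpos : ∀ᵐ r ∂ρ.restrict (Ioi 0), ENNReal.ofReal (min 1 r) ≠ 0 := by
    filter_upwards [ae_restrict_mem measurableSet_Ioi] with r hr
    exact (ENNReal.ofReal_pos.2 (lt_min one_pos hr)).ne'
  have := isFiniteMeasure_withDensity_ofReal hρ.2
  exact sFinite_of_absolutelyContinuous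
    (withDensity_absolutelyContinuous' (by fun_prop) hpos)

lemma integrableOn_exp_mul_sub_one {w : ℂ} (hw : w.re ≤ 0) :
    IntegrableOn (fun r : ℝ => Complex.exp (w * r) - 1) (Ioi 0) ρ :=
  (hρ.const_mul (max 2 ‖w‖)).mono' (by fun_prop)
    ((ae_restrict_mem measurableSet_Ioi).mono fun _ hr => norm_exp_mul_sub_one_le hw (le_of_lt hr))

lemma continuousOn_levyExponent : ContinuousOn (levyExponent ρ) {w | w.re ≤ 0} := by
  intro w _
  refine continuousWithinAt_of_dominated (bound := fun r => max 2 (‖w‖ + 1) * min 1 r)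
    (Eventually.of_forall fun z => by fun_prop) ?_ (hρ.const_mul _)
    (ae_of_all _ fun r => by fun_prop)
  have hnorm : ∀ᶠ z in 𝓝[{w : ℂ | w.re ≤ 0}] w, ‖z‖ < ‖w‖ + 1 :=
    (continuous_norm.continuousWithinAt).eventually_lt_const (lt_add_one _)
  filter_upwards [hnorm, self_mem_nhdsWithin] with z hz hz_re
  filter_upwards [ae_restrict_mem measurableSet_Ioi] with r hr
  have : 0 ≤ min 1 r := (lt_min one_pos hr).le
  exact (norm_exp_mul_sub_one_le hz_re (le_of_lt hr)).trans (by gcongr)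

lemma re_levyExponent_nonpos {w : ℂ} (hw : w.re ≤ 0) : (levyExponent ρ w).re ≤ 0 := by
  rw [levyExponent, ← RCLike.re_eq_complex_re, ← integral_re (integrableOn_exp_mul_sub_one hρ hw)]
  refine setIntegral_nonpos measurableSet_Ioi fun r hr => ?_
  simpa using (Complex.re_le_norm _).trans (norm_exp_mul_le_one hw (le_of_lt hr))

lemma Iio_subset_integrableExpSet_sizeBiased : Iio 0 ⊆ integrableExpSet id (sizeBiased ρ) := by
  intro t ht
  refine integrable_sizeBiased_iff.2
    ((hρ.const_mul (max 1 (-t)⁻¹)).mono' (by fun_prop) ?_)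
  filter_upwards [ae_restrict_mem measurableSet_Ioi] with r (hr : 0 < r)
  rw [smul_eq_mul, Real.norm_of_nonneg (by positivity)]
  exact mul_exp_mul_le ht hr.le

lemma mem_interior_integrableExpSet_sizeBiased {t : ℝ} (ht : t < 0) :
    t ∈ interior (integrableExpSet id (sizeBiased ρ)) :=
  interior_maximal (Iio_subset_integrableExpSet_sizeBiased hρ) isOpen_Iio ht

lemma hasDerivAt_levyExponent {w : ℂ} (hw : w.re < 0) :
    HasDerivAt (levyExponent ρ) (complexMGF id (sizeBiased ρ) w) w := by
  have ht : w.re / 2 < 0 := by linarith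
  rw [complexMGF, integral_sizeBiased]
  refine (hasDerivAt_integral_of_dominated_loc_of_deriv_le (s := {z : ℂ | z.re < w.re / 2})
    (bound := fun r => max 1 (-(w.re / 2))⁻¹ * min 1 r)
    (F := fun (z : ℂ) (r : ℝ) => Complex.exp (z * r) - 1)
    (F' := fun (z : ℂ) (r : ℝ) => r • Complex.exp (z * r))
    ((isOpen_lt Complex.continuous_re continuous_const).mem_nhds (show w.re < w.re / 2 by linarith))
    (Eventually.of_forall fun z => by fun_prop)
    (integrableOn_exp_mul_sub_one hρ hw.le) (by fun_prop) ?_ (hρ.const_mul _) ?_).2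
  · filter_upwards [ae_restrict_mem measurableSet_Ioi] with r (hr : 0 < r) z (hz : z.re < w.re / 2)
    rw [norm_smul, Real.norm_of_nonneg hr.le, Complex.norm_exp, Complex.re_mul_ofReal]
    refine le_trans ?_ (mul_exp_mul_le ht hr.le)
    gcongr
  · refine ae_of_all _ fun r z _ => ?_
    simpa [mul_comm] using ((hasDerivAt_id z).mul_const (r : ℂ)).cexp.sub_const 1

lemma differentiableOn_levyExponent : DifferentiableOn ℂ (levyExponent ρ) {w | w.re < 0} :=
  fun _ hw => (hasDerivAt_levyExponent hρ hw).differentiableAt.differentiableWithinAt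

lemma iteratedDeriv_succ_levyExponent (n : ℕ) :
    iteratedDeriv (n + 1) (levyExponent ρ) (-1) = kappa ρ (n + 1) := by
  have hneg : (-1 : ℂ).re < 0 := by simp
  have hderiv : deriv (levyExponent ρ) =ᶠ[𝓝 (-1)] complexMGF id (sizeBiased ρ) :=
    eventually_of_mem (setOf_re_neg_mem_nhds hneg) fun w hw => (hasDerivAt_levyExponent hρ hw).deriv
  rw [iteratedDeriv_succ', hderiv.iteratedDeriv_eq,
    iteratedDeriv_complexMGF (mem_interior_integrableExpSet_sizeBiased hρ hneg),
    integral_sizeBiased, kappa, ← integral_complex_ofReal]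
  simp [pow_succ', mul_assoc]

lemma integrableOn_pow_mul_exp_neg (n : ℕ) :
    IntegrableOn (fun r : ℝ => r ^ (n + 1) * Real.exp (-r)) (Ioi 0) ρ := by
  have h := integrable_sizeBiased_iff.1 (integrable_pow_mul_exp_of_mem_interior_integrableExpSet
    (mem_interior_integrableExpSet_sizeBiased hρ (neg_one_lt_zero)) n)
  simpa only [id, smul_eq_mul, neg_mul, one_mul, ← mul_assoc, ← pow_succ'] using h

lemma kappa_pos (hρ0 : ρ (Ioi 0) ≠ 0) {n : ℕ} (hn : n ≠ 0) : 0 < kappa ρ n := by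
  obtain ⟨n, rfl⟩ := Nat.exists_eq_succ_of_ne_zero hn
  have hpos : ∀ r ∈ Ioi (0 : ℝ), 0 < r ^ (n + 1) * Real.exp (-r) := fun r hr =>
    mul_pos (pow_pos hr _) (Real.exp_pos _)
  have hsupp : Ioi 0 ⊆ Function.support fun r : ℝ => r ^ (n + 1) * Real.exp (-r) :=
    fun r hr => (hpos r hr).ne'
  rw [kappa, setIntegral_pos_iff_support_of_nonneg_ae
    ((ae_restrict_mem measurableSet_Ioi).mono fun _ hr => (hpos _ hr).le)
    (integrableOn_pow_mul_exp_neg hρ n), inter_eq_right.2 hsupp]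
  exact pos_iff_ne_zero.2 hρ0

end LevyExponent

section ComplexAnalysis

lemma eq_zero_of_bounded_of_eq_zero_on_imaginary_axis {E : Type*} [NormedAddCommGroup E]
    [NormedSpace ℂ E] {f : ℂ → E} {C : ℝ}
    (hf : DiffContOnCl ℂ f {z | z.re < 0}) (hC : ∀ z : ℂ, z.re ≤ 0 → ‖f z‖ ≤ C)
    (him : ∀ u : ℝ, f (u * Complex.I) = 0) {z : ℂ} (hz : z.re ≤ 0) : f z = 0 := by
  have hmaps : MapsTo (fun w : ℂ => -w) {w | 0 < w.re} {w | w.re < 0} := fun w hw => by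
    simpa using hw
  have hbound : ∀ w : ℂ, 0 ≤ w.re → ‖f (-w)‖ ≤ C := fun w hw => hC _ (by simpa using hw)
  have key : ‖f (- -z)‖ ≤ 0 := by
    refine PhragmenLindelof.right_half_plane_of_bounded_on_real (f := fun w => f (-w))
      (hf.comp differentiable_neg.diffContOnCl hmaps) ⟨1, one_lt_two, 0, ?_⟩
      ⟨C, ?_⟩ (fun x => ?_) (by simpa using hz)
    · refine Asymptotics.IsBigO.of_bound C ?_
      filter_upwards [mem_inf_of_right (mem_principal_self _)] with w hw
      simpa using hbound w (le_of_lt hw)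
    · refine eventually_map.2 ?_
      filter_upwards [eventually_ge_atTop 0] with x hx
      exact hbound _ (by simpa using hx)
    · rw [show -(x * Complex.I) = (-x : ℝ) * Complex.I by push_cast; ring, him, norm_zero]
  simpa using key

lemma exists_norm_iteratedDeriv_exp_mul_sub_le {ψ : ℂ → ℂ} {z : ℂ} (hψ : AnalyticAt ℂ ψ z)
    (n : ℕ) (c : ℝ) :
    ∃ C, 0 ≤ C ∧ ∀ a : ℂ, ‖a‖ ≤ c →
      ‖iteratedDeriv (n + 1) (fun w => Complex.exp (a * ψ w)) z - a * iteratedDeriv (n + 1) ψ z‖ ≤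
        C * ‖a‖ ^ 2 := by
  obtain ⟨R, hR, hdisc⟩ := Metric.nhds_basis_closedBall.mem_iff.1 hψ.eventually_analyticAt
  have hψan : AnalyticOnNhd ℂ ψ (Metric.closedBall z R) := fun w hw => hdisc hw
  obtain ⟨K, hK⟩ := (isCompact_closedBall z R).exists_bound_of_continuousOn hψan.continuousOn
  refine ⟨(n + 1).factorial * (K ^ 2 * Real.exp (c * K)) / R ^ (n + 1), by positivity,
    fun a ha => ?_⟩
  have hremainder : ∀ w ∈ Metric.sphere z R,
      ‖Complex.exp (a * ψ w) - (1 + a * ψ w)‖ ≤ ‖a‖ ^ 2 * (K ^ 2 * Real.exp (c * K)) := by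
    intro w hw
    have hc : 0 ≤ c := (norm_nonneg a).trans ha
    have hψw : ‖ψ w‖ ≤ K := hK w (Metric.sphere_subset_closedBall hw)
    have htaylor := Complex.norm_exp_sub_sum_le_norm_mul_exp (a * ψ w) 2
    rw [norm_mul] at htaylor
    calc ‖Complex.exp (a * ψ w) - (1 + a * ψ w)‖
        ≤ (‖a‖ * ‖ψ w‖) ^ 2 * Real.exp (‖a‖ * ‖ψ w‖) := by
          simpa [Finset.sum_range_succ] using htaylor
      _ ≤ (‖a‖ * K) ^ 2 * Real.exp (c * K) := by gcongr
      _ = ‖a‖ ^ 2 * (K ^ 2 * Real.exp (c * K)) := by ring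
  have hexp : AnalyticOnNhd ℂ (fun w => Complex.exp (a * ψ w)) (Metric.closedBall z R) :=
    fun w hw => (analyticAt_const.mul (hψan w hw)).cexp
  have hlin : AnalyticOnNhd ℂ (fun w => 1 + a * ψ w) (Metric.closedBall z R) :=
    fun w hw => analyticAt_const.add (analyticAt_const.mul (hψan w hw))
  have hcauchy := Complex.norm_iteratedDeriv_le_of_forall_mem_sphere_norm_le (n + 1) hR
    ((hexp.sub hlin).differentiableOn.diffContOnCl_ball subset_rfl) hremainder
  rw [iteratedDeriv_sub (hexp z (Metric.mem_closedBall_self hR.le)).contDiffAt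
    (hlin z (Metric.mem_closedBall_self hR.le)).contDiffAt, iteratedDeriv_const_add n.succ_pos,
    iteratedDeriv_const_mul_field] at hcauchy
  exact hcauchy.trans_eq (by ring)

end ComplexAnalysis

section SubordinatorValue

variable {S : Type*} [MeasurableSpace S] {P : Measure S} {X : S → ℝ}

/-- `X` has the law of the value at time `a` of the driftless subordinator with Lévy measure `ρ` on
`(0, ∞)`. This is the law of the mass that a homogeneous completely random measure gives to a set
of base measure `a`. The Lévy–Khintchine formula is required on the imaginary axis only. -/
structure IsSubordinatorValue (P : Measure S) (X : S → ℝ) (ρ : Measure ℝ) (a : ℝ) : Prop where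
  measurable : Measurable X
  nonneg : ∀ s, 0 ≤ X s
  time_nonneg : 0 ≤ a
  complexMGF_mul_I : ∀ u : ℝ,
    complexMGF X P (u * Complex.I) = Complex.exp (a * levyExponent ρ (u * Complex.I))

/-- The `n`-th moment of `X` under the exponentially tilted law, `E[Xⁿ e^{-X}] / E[e^{-X}]`. -/
def tiltedMoment (P : Measure S) (X : S → ℝ) (n : ℕ) : ℝ :=
  moment X n (P.tilted fun s => -X s)

lemma tiltedMoment_eq_div (n : ℕ) :
    tiltedMoment P X n = (∫ s, X s ^ n * Real.exp (-X s) ∂P) / ∫ s, Real.exp (-X s) ∂P := by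
  rw [tiltedMoment, moment, integral_tilted, ← integral_div]
  refine integral_congr_ae (ae_of_all _ fun s => ?_)
  simp only [Pi.pow_apply, smul_eq_mul]
  ring

lemma tiltedMoment_nonneg (hX0 : ∀ s, 0 ≤ X s) (n : ℕ) : 0 ≤ tiltedMoment P X n :=
  integral_nonneg fun s => pow_nonneg (hX0 s) n

variable [IsFiniteMeasure P]

lemma mem_interior_integrableExpSet_of_nonneg (hX : Measurable X) (hX0 : ∀ s, 0 ≤ X s) {t : ℝ}
    (ht : t < 0) : t ∈ interior (integrableExpSet X P) := by
  refine interior_maximal (fun u (hu : u < 0) => ?_) isOpen_Iio ht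
  refine (integrable_const (1 : ℝ)).mono' (by fun_prop) (ae_of_all _ fun s => ?_)
  rw [Real.norm_of_nonneg (Real.exp_pos _).le]
  exact Real.exp_le_one_iff.2 (mul_nonpos_of_nonpos_of_nonneg hu.le (hX0 s))

lemma norm_complexMGF_le_of_nonneg (hX0 : ∀ s, 0 ≤ X s) {w : ℂ} (hw : w.re ≤ 0) :
    ‖complexMGF X P w‖ ≤ P.real univ := by
  simpa [complexMGF] using norm_integral_le_of_norm_le_const
    (ae_of_all P fun s => norm_exp_mul_le_one hw (hX0 s))

lemma diffContOnCl_complexMGF_of_nonneg (hX : Measurable X) (hX0 : ∀ s, 0 ≤ X s) :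
    DiffContOnCl ℂ (complexMGF X P) {w | w.re < 0} := by
  refine ⟨differentiableOn_complexMGF.mono fun w hw =>
    mem_interior_integrableExpSet_of_nonneg hX hX0 hw, ?_⟩
  rw [Complex.closure_setOfPred_re_lt]
  refine fun w _ => continuousWithinAt_of_dominated (bound := fun _ => 1)
    (Eventually.of_forall fun z => by fun_prop) ?_ (integrable_const _)
    (ae_of_all _ fun s => by fun_prop)
  filter_upwards [self_mem_nhdsWithin] with z hz
  exact ae_of_all _ fun s => norm_exp_mul_le_one hz (hX0 s)

lemma tiltedMoment_eq_iteratedDeriv (hX : Measurable X) (hX0 : ∀ s, 0 ≤ X s) (n : ℕ) :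
    (tiltedMoment P X n : ℂ) = iteratedDeriv n (complexMGF X P) (-1) / complexMGF X P (-1) := by
  rw [iteratedDeriv_complexMGF (mem_interior_integrableExpSet_of_nonneg hX hX0 (by simp)),
    tiltedMoment_eq_div, complexMGF]
  push_cast [← integral_complex_ofReal]
  simp

variable {ρ : Measure ℝ} {a : ℝ} (hρ : IntegrableOn (fun r => min 1 r) (Ioi 0) ρ)
include hρ

lemma IsSubordinatorValue.complexMGF_eq (hX : IsSubordinatorValue P X ρ a) {w : ℂ}
    (hw : w.re ≤ 0) : complexMGF X P w = Complex.exp (a * levyExponent ρ w) := by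
  have hdiff : DiffContOnCl ℂ (fun z => complexMGF X P z - Complex.exp (a * levyExponent ρ z))
      {z | z.re < 0} := by
    refine (diffContOnCl_complexMGF_of_nonneg hX.measurable hX.nonneg).sub
      ⟨((differentiableOn_levyExponent hρ).const_mul _).cexp, ?_⟩
    rw [Complex.closure_setOfPred_re_lt]
    exact (continuousOn_const.mul (continuousOn_levyExponent hρ)).cexp
  refine sub_eq_zero.1 (eq_zero_of_bounded_of_eq_zero_on_imaginary_axis hdiff
    (C := P.real univ + 1) (fun z hz => (norm_sub_le _ _).trans (add_le_add
      (norm_complexMGF_le_of_nonneg hX.nonneg hz) ?_))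
    (fun u => sub_eq_zero.2 (hX.complexMGF_mul_I u)) hw)
  rw [Complex.norm_exp, Complex.re_ofReal_mul]
  exact Real.exp_le_one_iff.2
    (mul_nonpos_of_nonneg_of_nonpos hX.time_nonneg (re_levyExponent_nonpos hρ hz))

lemma IsSubordinatorValue.tiltedMoment_eq_iteratedDeriv_exp (hX : IsSubordinatorValue P X ρ a)
    (n : ℕ) :
    (tiltedMoment P X n : ℂ) = iteratedDeriv n
      (fun w => Complex.exp (a * (levyExponent ρ w - levyExponent ρ (-1)))) (-1) := by
  have hexp : (fun w => Complex.exp (a * (levyExponent ρ w - levyExponent ρ (-1)))) =ᶠ[𝓝 (-1)]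
      fun w => (complexMGF X P (-1))⁻¹ * complexMGF X P w := by
    filter_upwards [setOf_re_neg_mem_nhds (w := -1) (by simp)] with w hw
    rw [hX.complexMGF_eq hρ (le_of_lt hw), hX.complexMGF_eq hρ (by simp), mul_sub, Complex.exp_sub,
      div_eq_inv_mul]
  rw [hexp.iteratedDeriv_eq, iteratedDeriv_const_mul_field, ← div_eq_inv_mul,
    CountMixture.tiltedMoment_eq_iteratedDeriv hX.measurable hX.nonneg]

theorem exists_abs_tiltedMoment_sub_le (P : Measure S) [IsFiniteMeasure P] (n : ℕ) (c : ℝ) :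
    ∃ C, 0 ≤ C ∧ ∀ (X : S → ℝ) (a : ℝ), IsSubordinatorValue P X ρ a → a ≤ c →
      |tiltedMoment P X (n + 1) - a * kappa ρ (n + 1)| ≤ C * a ^ 2 := by
  have hφ : AnalyticAt ℂ (levyExponent ρ) (-1) :=
    (differentiableOn_levyExponent hρ).analyticAt (setOf_re_neg_mem_nhds (by simp))
  obtain ⟨C, hC0, hC⟩ := exists_norm_iteratedDeriv_exp_mul_sub_le (hφ.sub analyticAt_const) n c
  refine ⟨C, hC0, fun X a hX hac => ?_⟩
  have h := hC a (by rwa [Complex.norm_real, Real.norm_of_nonneg hX.time_nonneg])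
  simp only [Pi.sub_apply] at h
  rw [← hX.tiltedMoment_eq_iteratedDeriv_exp hρ,
    iteratedDeriv_sub hφ.contDiffAt contDiffAt_const, iteratedDeriv_const, if_neg n.succ_ne_zero,
    sub_zero, iteratedDeriv_succ_levyExponent hρ] at h
  rw [Complex.norm_real, Real.norm_eq_abs, sq_abs] at h
  exact_mod_cast h

end SubordinatorValue

section CompletelyRandomMeasure

namespace IsCompletelyRandomMeasure

variable {S Ω : Type*} [MeasurableSpace S] [MeasurableSpace Ω] {P : Measure S}
  {ν : Measure (ℝ × Ω)} {G : S → Measure Ω}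

lemma measurable_real (hG : IsCompletelyRandomMeasure P G ν) {A : Set Ω} (hA : MeasurableSet A) :
    Measurable fun s => (G s).real A :=
  ((Measure.measurable_coe hA).comp hG.measurable).ennreal_toReal

lemma iIndepFun_comp_real (hG : IsCompletelyRandomMeasure P G ν) {ι : Type*} [Finite ι]
    {A : ι → Set Ω} (hA : ∀ i, MeasurableSet (A i)) (hdisj : Pairwise (Function.onFun Disjoint A))
    {f : ι → ℝ → ℝ} (hf : ∀ i, Measurable (f i)) :
    iIndepFun (fun i s => f i ((G s).real (A i))) P := by
  let e := Finite.equivFin ι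
  have h := (hG.indep (Nat.card ι) (A ∘ e.symm) (fun k => hA _)
    (fun j k hjk => hdisj (e.symm.injective.ne hjk))).precomp e.injective
  simp only [Function.comp_apply, Equiv.symm_apply_apply] at h
  exact h.comp (fun i x => f i x.toReal) fun i => (hf i).comp ENNReal.measurable_toReal

lemma integral_exp_neg_mul_prod_pow_of_partition (hG : IsCompletelyRandomMeasure P G ν)
    {ι : Type*} [Fintype ι] {A : ι → Set Ω} (hA : ∀ i, MeasurableSet (A i))
    (hdisj : Pairwise (Function.onFun Disjoint A)) (hunion : ⋃ i, A i = univ) (n : ι → ℕ) :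
    ∫ s, Real.exp (-(G s).real univ) * ∏ i, (G s).real (A i) ^ n i ∂P =
      ∏ i, ∫ s, (G s).real (A i) ^ n i * Real.exp (-(G s).real (A i)) ∂P := by
  rw [← (hG.iIndepFun_comp_real hA hdisj (f := fun i x => x ^ n i * Real.exp (-x))
    (fun i => by fun_prop)).integral_fun_prod_eq_prod_integral fun i =>
      (((hG.measurable_real (hA i)).pow_const _).mul
        (hG.measurable_real (hA i)).neg.exp).aestronglyMeasurable]
  refine integral_congr_ae ?_
  filter_upwards [hG.finite] with s hs
  have : IsFiniteMeasure (G s) := ⟨hs⟩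
  rw [Finset.prod_mul_distrib, ← Real.exp_sum, Finset.sum_neg_distrib, ← hunion,
    measureReal_iUnion_fintype hdisj hA, mul_comm]

lemma isSubordinatorValue_real {ρ : Measure ℝ} {G₀ : Measure Ω} [IsFiniteMeasure G₀]
    (hρ : IntegrableOn (fun r => min 1 r) (Ioi 0) ρ)
    (hG : IsCompletelyRandomMeasure P G (levyMeasure ρ G₀)) {A : Set Ω} (hA : MeasurableSet A) :
    IsSubordinatorValue P (fun s => (G s).real A) ρ (G₀.real A) where
  measurable := hG.measurable_real hA
  nonneg _ := measureReal_nonneg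
  time_nonneg := measureReal_nonneg
  complexMGF_mul_I u := by
    have := sFinite_restrict_Ioi hρ
    have hrestrict : (levyMeasure ρ G₀).restrict (univ ×ˢ A) =
        (ρ.restrict (Ioi 0)).prod (G₀.restrict A) := by
      rw [levyMeasure, ← Measure.prod_restrict, Measure.restrict_univ]
    have hchar := hG.charFun_eq A hA u
    rw [hrestrict, integral_fun_fst fun r : ℝ => Complex.exp (Complex.I * u * r) - 1,
      measureReal_restrict_apply_univ, Complex.real_smul] at hchar
    simpa only [complexMGF, levyExponent, Measure.real, mul_comm (u : ℂ) Complex.I] using hchar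

variable [IsProbabilityMeasure P]

lemma integral_exp_neg_pos (hG : IsCompletelyRandomMeasure P G ν) {A : Set Ω}
    (hA : MeasurableSet A) : 0 < ∫ s, Real.exp (-(G s).real A) ∂P := by
  refine integral_exp_pos ((integrable_const (1 : ℝ)).mono'
    (hG.measurable_real hA).neg.exp.aestronglyMeasurable (ae_of_all _ fun s => ?_))
  rw [Real.norm_of_nonneg (Real.exp_pos _).le]
  exact Real.exp_le_one_iff.2 (neg_nonpos.2 measureReal_nonneg)

theorem integral_exp_neg_mul_prod_pow (hG : IsCompletelyRandomMeasure P G ν)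
    {l : ℕ} {A : Fin l → Set Ω} (hA : ∀ j, MeasurableSet (A j))
    (hdisj : Pairwise (Function.onFun Disjoint A)) (n : Fin l → ℕ) :
    ∫ s, Real.exp (-(G s).real univ) * ∏ j, (G s).real (A j) ^ n j ∂P =
      (∫ s, Real.exp (-(G s).real univ) ∂P) *
        ∏ j, tiltedMoment P (fun s => (G s).real (A j)) (n j) := by
  set B : Option (Fin l) → Set Ω := fun o => o.elim (⋃ j, A j)ᶜ A with hB_def
  have hB : ∀ o, MeasurableSet (B o) := by
    rintro (_ | j)
    exacts [(MeasurableSet.iUnion hA).compl, hA j]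
  have hBdisj : Pairwise (Function.onFun Disjoint B) := by
    rintro (_ | j) (_ | k) hjk
    · exact absurd rfl hjk
    · exact (disjoint_compl_left_iff_subset.2 (subset_iUnion A k))
    · exact (disjoint_compl_right_iff_subset.2 (subset_iUnion A j))
    · exact hdisj fun h => hjk (congrArg some h)
  have hBunion : ⋃ o, B o = univ := by
    rw [iUnion_option]
    exact compl_union_self _
  have hmoments := hG.integral_exp_neg_mul_prod_pow_of_partition hB hBdisj hBunion
    fun o => o.elim 0 n
  have htotal := hG.integral_exp_neg_mul_prod_pow_of_partition hB hBdisj hBunion fun _ => 0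
  simp only [Fintype.prod_option, pow_zero, one_mul, Finset.prod_const_one, mul_one, hB_def,
    Option.elim_none, Option.elim_some] at hmoments htotal
  simp only [tiltedMoment_eq_div, Finset.prod_div_distrib]
  rw [hmoments, htotal]
  have : ∏ j, ∫ s, Real.exp (-(G s).real (A j)) ∂P ≠ 0 :=
    Finset.prod_ne_zero_iff.2 fun j _ => (hG.integral_exp_neg_pos (hA j)).ne'
  field_simp

end IsCompletelyRandomMeasure

end CompletelyRandomMeasure

section EmbeddingSums

open Classical in
lemma sum_embedding_fin_succ {ι R : Type*} [Fintype ι] [CommRing R] {l : ℕ}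
    (h : Fin (l + 1) → ι → R) :
    ∑ c : Fin (l + 1) ↪ ι, ∏ j, h j (c j) =
      ∑ e : Fin l ↪ ι, ((∑ x, h 0 x) - ∑ j, h 0 (e j)) * ∏ j, h j.succ (e j) := by
  rw [Fintype.sum_equiv (Equiv.embeddingFinSucc l ι) _
    (fun p : (e : Fin l ↪ ι) × {x // x ∉ range e} => h 0 p.2 * ∏ j, h j.succ (p.1 j))
    (fun c => by simp [Fin.prod_univ_succ]), Fintype.sum_sigma]
  refine Finset.sum_congr rfl fun e _ => ?_
  have hcompl : ∑ x : {x // x ∉ range e}, h 0 x = (∑ x, h 0 x) - ∑ j, h 0 (e j) := by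
    rw [eq_sub_iff_add_eq', ← Fintype.sum_subtype_add_sum_subtype (· ∈ range e) (h 0)]
    congr 1
    convert (Equiv.ofInjective e e.injective).sum_comp fun x => h 0 x
    rfl
  rw [← hcompl, Finset.sum_mul]

open Classical in
lemma abs_sum_embedding_fin_succ_sub_le {ι : Type*} [Fintype ι] {l : ℕ} {h : Fin (l + 1) → ι → ℝ}
    (h0 : ∀ j x, 0 ≤ h j x) {ε : ℝ} (hε : ∀ x, h 0 x ≤ ε) :
    |∑ c : Fin (l + 1) ↪ ι, ∏ j, h j (c j) -
        (∑ x, h 0 x) * ∑ e : Fin l ↪ ι, ∏ j, h j.succ (e j)| ≤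
      (l * ε) * ∑ e : Fin l ↪ ι, ∏ j, h j.succ (e j) := by
  have hprod : ∀ e : Fin l ↪ ι, 0 ≤ ∏ j, h j.succ (e j) := fun e =>
    Finset.prod_nonneg fun j _ => h0 _ _
  simp only [sum_embedding_fin_succ, sub_mul, Finset.sum_sub_distrib, Finset.mul_sum,
    sub_sub_cancel_left, abs_neg]
  rw [abs_of_nonneg (Finset.sum_nonneg fun e _ =>
    mul_nonneg (Finset.sum_nonneg fun j _ => h0 _ _) (hprod e))]
  refine Finset.sum_le_sum fun e _ => mul_le_mul_of_nonneg_right ?_ (hprod e)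
  simpa using Finset.sum_le_sum fun j (_ : j ∈ Finset.univ) => hε (e j)

open Classical in
theorem tendsto_sum_embedding_prod {ι : ℕ → Type*} [∀ N, Fintype (ι N)] {l : ℕ}
    {h : ∀ N, Fin l → ι N → ℝ} (h0 : ∀ N j x, 0 ≤ h N j x) {b : Fin l → ℝ}
    (hb : ∀ j, Tendsto (fun N => ∑ x, h N j x) atTop (𝓝 (b j)))
    {ε : Fin l → ℕ → ℝ} (hε : ∀ N j x, h N j x ≤ ε j N)
    (hε0 : ∀ j, Tendsto (ε j) atTop (𝓝 0)) :
    Tendsto (fun N => ∑ c : Fin l ↪ ι N, ∏ j, h N j (c j)) atTop (𝓝 (∏ j, b j)) := by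
  induction l with
  | zero => simp
  | succ l ih =>
    have htail := ih (fun N j x => h0 N j.succ x) (fun j => hb j.succ) (fun N j x => hε N j.succ x)
      (fun j => hε0 j.succ)
    have herror := ((hε0 0).const_mul (l : ℝ)).mul htail
    simp only [mul_zero, zero_mul] at herror
    rw [Fin.prod_univ_succ]
    simpa using (squeeze_zero_norm (fun N => (Real.norm_eq_abs _).trans_le
      (abs_sum_embedding_fin_succ_sub_le (h0 N) (hε N 0))) herror).add ((hb 0).mul htail)

variable {ι : ℕ → Type*} [∀ N, Fintype (ι N)] {a : ∀ N, ι N → ℝ} {γ : ℝ}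

lemma tendsto_sum_of_abs_sub_mul_le (hsum : ∀ N, ∑ x, a N x = γ)
    (hsq : Tendsto (fun N => ∑ x, a N x ^ 2) atTop (𝓝 0)) {κ C : ℝ} {h : ∀ N, ι N → ℝ}
    (hh : ∀ N x, |h N x - a N x * κ| ≤ C * a N x ^ 2) :
    Tendsto (fun N => ∑ x, h N x) atTop (𝓝 (γ * κ)) := by
  refine tendsto_sub_nhds_zero_iff.1 (squeeze_zero_norm (fun N => ?_)
    (by simpa using hsq.const_mul C))
  rw [Real.norm_eq_abs, ← hsum N, Finset.sum_mul, ← Finset.sum_sub_distrib, Finset.mul_sum]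
  exact (Finset.abs_sum_le_sum_abs _ _).trans (Finset.sum_le_sum fun x _ => hh N x)

lemma le_sqrt_sum_sq_mul_add {ι : Type*} [Fintype ι] {a : ι → ℝ} {κ C y : ℝ} (hκ : 0 ≤ κ)
    (hC : 0 ≤ C) {x : ι} (hy : |y - a x * κ| ≤ C * a x ^ 2) :
    y ≤ √(∑ x, a x ^ 2) * κ + C * ∑ x, a x ^ 2 := by
  have hsq : a x ^ 2 ≤ ∑ x, a x ^ 2 :=
    Finset.single_le_sum (f := fun x => a x ^ 2) (fun x _ => sq_nonneg _) (Finset.mem_univ x)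
  calc y ≤ a x * κ + C * a x ^ 2 := by linarith [(abs_le.1 hy).2]
    _ ≤ √(∑ x, a x ^ 2) * κ + C * ∑ x, a x ^ 2 := by
      gcongr
      exact Real.le_sqrt_of_sq_le hsq

theorem tendsto_sum_embedding_prod_of_abs_sub_mul_le (hsum : ∀ N, ∑ x, a N x = γ)
    (hsq : Tendsto (fun N => ∑ x, a N x ^ 2) atTop (𝓝 0)) {l : ℕ} {κ C : Fin l → ℝ}
    (hκ : ∀ j, 0 ≤ κ j) (hC : ∀ j, 0 ≤ C j) {h : ∀ N, Fin l → ι N → ℝ}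
    (h0 : ∀ N j x, 0 ≤ h N j x) (hh : ∀ N j x, |h N j x - a N x * κ j| ≤ C j * a N x ^ 2) :
    Tendsto (fun N => ∑ c : Fin l ↪ ι N, ∏ j, h N j (c j)) atTop (𝓝 (∏ j, γ * κ j)) := by
  have hsqrt : Tendsto (fun N => √(∑ x, a N x ^ 2)) atTop (𝓝 0) := by
    simpa using hsq.sqrt
  refine tendsto_sum_embedding_prod h0
    (fun j => tendsto_sum_of_abs_sub_mul_le hsum hsq fun N x => hh N j x)
    (fun N j x => le_sqrt_sum_sq_mul_add (hκ j) (hC j) (hh N j x)) fun j => ?_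
  simpa using (hsqrt.mul_const (κ j)).add (hsq.const_mul (C j))

end EmbeddingSums

section SeparatingSequence

variable {Ω : Type*} [MeasurableSpace Ω]

/-- A sequence of measurable partitions of `Ω`, given by the map `φ N` that sends each point to the
label of its cell, such that any two distinct points eventually lie in different cells. -/
structure IsSeparatingSequence {ι : ℕ → Type*} [∀ N, MeasurableSpace (ι N)]
    (φ : ∀ N, Ω → ι N) : Prop where
  measurable : ∀ N, Measurable (φ N)
  separates : ∀ x y, x ≠ y → ∀ᶠ N in atTop, φ N x ≠ φ N y

lemma exists_isSeparatingSequence (Ω : Type*) [MeasurableSpace Ω]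
    [MeasurableSpace.CountablySeparated Ω] :
    ∃ φ : ∀ N : ℕ, Ω → (Fin N → Bool), IsSeparatingSequence φ := by
  obtain ⟨f, hf, hinj⟩ := MeasurableSpace.measurable_injection_nat_bool_of_countablySeparated Ω
  refine ⟨fun N x i => f x i, fun N => by fun_prop, fun x y hxy => ?_⟩
  obtain ⟨k, hk⟩ := Function.ne_iff.1 (hinj.ne hxy)
  filter_upwards [eventually_gt_atTop k] with N hN heq
  exact hk (congrFun heq ⟨k, hN⟩)

lemma sum_measureReal_preimage_singleton_univ {ι : Type*} [Fintype ι] [MeasurableSpace ι]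
    [MeasurableSingletonClass ι] (μ : Measure Ω) [IsFiniteMeasure μ] {f : Ω → ι}
    (hf : Measurable f) : ∑ c, μ.real (f ⁻¹' {c}) = μ.real univ := by
  rw [sum_measureReal_preimage_singleton _ fun c _ => hf (measurableSet_singleton c)]
  simp

variable {ι : ℕ → Type*} [∀ N, Fintype (ι N)] [∀ N, MeasurableSpace (ι N)]
  [∀ N, MeasurableSingletonClass (ι N)] {φ : ∀ N, Ω → ι N}

namespace IsSeparatingSequence

omit [∀ N, Fintype (ι N)] in
lemma tendsto_measureReal_cell (hφ : IsSeparatingSequence φ) (μ : Measure Ω) [IsFiniteMeasure μ]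
    [NullSingletonClass μ] (x : Ω) :
    Tendsto (fun N => μ.real (φ N ⁻¹' {φ N x})) atTop (𝓝 0) := by
  have hlim : ∀ᵐ y ∂μ, ∀ᶠ N in atTop, y ∈ φ N ⁻¹' {φ N x} ↔ y ∈ (∅ : Set Ω) := by
    filter_upwards [compl_mem_ae_iff.2 (measure_singleton x)] with y hy
    filter_upwards [hφ.separates y x hy] with N hN
    simpa using hN
  have h := tendsto_measure_of_ae_tendsto_indicator_of_isFiniteMeasure atTop
    MeasurableSet.empty (fun N => hφ.measurable N (measurableSet_singleton _)) hlim
  simpa [Function.comp_def, Measure.real] using (ENNReal.tendsto_toReal (by simp)).comp h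

lemma tendsto_sum_sq (hφ : IsSeparatingSequence φ) (μ : Measure Ω) [IsFiniteMeasure μ]
    [NullSingletonClass μ] :
    Tendsto (fun N => ∑ c, μ.real (φ N ⁻¹' {c}) ^ 2) atTop (𝓝 0) := by
  have hcell : ∀ N, Measurable fun c => μ.real (φ N ⁻¹' {c}) := fun N => measurable_of_finite _
  have hsum : ∀ N, ∑ c, μ.real (φ N ⁻¹' {c}) ^ 2 = ∫ x, μ.real (φ N ⁻¹' {φ N x}) ∂μ := by
    intro N
    rw [← integral_map (φ := φ N) (f := fun c => μ.real (φ N ⁻¹' {c}))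
      (hφ.measurable N).aemeasurable (hcell N).aestronglyMeasurable, integral_fintype .of_finite]
    simp [map_measureReal_apply (hφ.measurable N), sq]
  simp only [hsum]
  rw [← integral_zero Ω ℝ (μ := μ)]
  refine tendsto_integral_of_dominated_convergence (fun _ => μ.real univ)
    (fun N => ((hcell N).comp (hφ.measurable N)).aestronglyMeasurable) (integrable_const _)
    (fun N => ae_of_all _ fun x => ?_) (ae_of_all _ fun x => hφ.tendsto_measureReal_cell μ x)
  rw [Real.norm_of_nonneg measureReal_nonneg]
  exact measureReal_mono (subset_univ _)

end IsSeparatingSequence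

end SeparatingSequence

section CompletelyRandomMeasureLimit

variable {S Ω : Type*} [MeasurableSpace S] [MeasurableSpace Ω] {P : Measure S} [IsFiniteMeasure P]
  {ρ : Measure ℝ} {G₀ : Measure Ω} [IsFiniteMeasure G₀] [NullSingletonClass G₀]
  {G : S → Measure Ω} {ι : ℕ → Type*} [∀ N, Fintype (ι N)] [∀ N, MeasurableSpace (ι N)]
  [∀ N, MeasurableSingletonClass (ι N)] {φ : ∀ N, Ω → ι N}

theorem IsSeparatingSequence.tendsto_sum_embedding_prod_tiltedMoment (hφ : IsSeparatingSequence φ)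
    (hρ : IntegrableOn (fun r => min 1 r) (Ioi 0) ρ)
    (hG : IsCompletelyRandomMeasure P G (levyMeasure ρ G₀)) {l : ℕ} {n : Fin l → ℕ}
    (hn : ∀ j, n j ≠ 0) :
    Tendsto (fun N => ∑ c : Fin l ↪ ι N,
        ∏ j, tiltedMoment P (fun s => (G s).real (φ N ⁻¹' {c j})) (n j))
      atTop (𝓝 (∏ j, G₀.real univ * kappa ρ (n j))) := by
  have hexpansion : ∀ j, ∃ C, 0 ≤ C ∧ ∀ (X : S → ℝ) (a : ℝ), IsSubordinatorValue P X ρ a →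
      a ≤ G₀.real univ → |tiltedMoment P X (n j) - a * kappa ρ (n j)| ≤ C * a ^ 2 := fun j => by
    rw [← Nat.succ_pred_eq_of_ne_zero (hn j)]
    exact exists_abs_tiltedMoment_sub_le hρ P _ _
  choose C hC0 hC using hexpansion
  refine tendsto_sum_embedding_prod_of_abs_sub_mul_le
    (fun N => sum_measureReal_preimage_singleton_univ G₀ (hφ.measurable N)) (hφ.tendsto_sum_sq G₀)
    (fun j => kappa_nonneg ρ (n j)) hC0
    (h := fun N j x => tiltedMoment P (fun s => (G s).real (φ N ⁻¹' {x})) (n j))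
    (fun N j x => tiltedMoment_nonneg (fun s => measureReal_nonneg) _) fun N j x => ?_
  exact hC j _ _ (hG.isSubordinatorValue_real hρ (hφ.measurable N (measurableSet_singleton x)))
    (measureReal_mono (subset_univ _))

end CompletelyRandomMeasureLimit

section Sample

lemma tsum_pi_prod_eq_prod_tsum {α : Type*} {m : ℕ} (f : Fin m → α → ℝ≥0∞) :
    ∑' k : Fin m → α, ∏ i, f i (k i) = ∏ i, ∑' a, f i a := by
  induction m with
  | zero => simp
  | succ m ih =>
    rw [← (Fin.consEquiv fun _ => α).tsum_eq, ENNReal.tsum_prod', Fin.prod_univ_succ, ← ih]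
    simp [Fin.consEquiv, Fin.prod_univ_succ, ENNReal.tsum_mul_left, ENNReal.tsum_mul_right]

-- At `T = 0` both sides vanish unless `m = 0`, since then all the weights vanish too.
lemma poissonMeasure_mul_prod_div {T : ℝ≥0} {m : ℕ} {w : Fin m → ℝ≥0} (hw : ∀ i, w i ≤ T) :
    (poissonMeasure T).real {m} * ∏ i, (w i : ℝ) / T =
      (m.factorial : ℝ)⁻¹ * Real.exp (-T) * ∏ i, (w i : ℝ) := by
  rw [poissonMeasure_real_singleton, Finset.prod_div_distrib, Finset.prod_const, Finset.card_univ,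
    Fintype.card_fin]
  rcases eq_or_ne T 0 with rfl | hT
  · rcases m with _ | m
    · simp
    · simp [Fin.prod_univ_succ, nonpos_iff_eq_zero.1 (hw 0)]
  · have : (T : ℝ) ≠ 0 := by exact_mod_cast hT
    field_simp

variable {S Ω : Type*} [MeasurableSpace Ω] {r : ℕ → S → ℝ≥0} {loc : ℕ → S → Ω}

/-- The σ-algebra generated by the weights and the locations of the atoms, on which the
count-mixture model conditions the sample. -/
abbrev atomSigmaAlgebra (r : ℕ → S → ℝ≥0) (loc : ℕ → S → Ω) : MeasurableSpace S :=
  MeasurableSpace.comap (fun s (k : ℕ) => (r k s, loc k s)) inferInstance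

lemma measurable_weight_atomSigmaAlgebra (k : ℕ) : Measurable[atomSigmaAlgebra r loc] (r k) :=
  fun _ ht => ⟨(fun x => (x k).1) ⁻¹' _, (measurable_pi_apply k).fst ht, rfl⟩

lemma measurable_loc_atomSigmaAlgebra (k : ℕ) : Measurable[atomSigmaAlgebra r loc] (loc k) :=
  fun _ ht => ⟨(fun x => (x k).2) ⁻¹' _, (measurable_pi_apply k).snd ht, rfl⟩

lemma atomicMeasure_apply {A : Set Ω} (hA : MeasurableSet A) (s : S) :
    atomicMeasure r loc s A = ∑' k, (r k s : ℝ≥0∞) * A.indicator 1 (loc k s) := by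
  rw [atomicMeasure, Measure.sum_apply _ hA]
  exact tsum_congr fun k => by rw [Measure.smul_apply, Measure.dirac_apply' _ hA, smul_eq_mul]

lemma le_atomicMeasure_univ (k : ℕ) (s : S) : (r k s : ℝ≥0∞) ≤ atomicMeasure r loc s univ := by
  rw [atomicMeasure_apply MeasurableSet.univ]
  simpa using ENNReal.le_tsum (f := fun k => (r k s : ℝ≥0∞)) k

lemma tsum_indicator_prod_eq_prod_atomicMeasure {m : ℕ} {A : Fin m → Set Ω}
    (hA : ∀ i, MeasurableSet (A i)) (s : S) :
    ∑' k : Fin m → ℕ, {s | ∀ i, loc (k i) s ∈ A i}.indicator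
        (fun s => ∏ i, (r (k i) s : ℝ≥0∞)) s = ∏ i, atomicMeasure r loc s (A i) := by
  simp only [atomicMeasure_apply (hA _)]
  rw [← tsum_pi_prod_eq_prod_tsum]
  refine tsum_congr fun k => ?_
  by_cases hs : ∀ i, loc (k i) s ∈ A i
  · rw [indicator_of_mem (by exact hs)]
    exact Finset.prod_congr rfl fun i _ => by simp [hs i]
  · rw [indicator_of_notMem (by exact hs)]
    obtain ⟨i, hi⟩ := not_forall.1 hs
    rw [Finset.prod_eq_zero (Finset.mem_univ i) (by simp [hi])]

namespace IsCountMixture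

variable [MeasurableSpace S] {P : Measure S} {ρ : Measure ℝ} {G₀ : Measure Ω} {M : S → ℕ}
  {Z : ℕ → S → ℕ} (hmodel : IsCountMixture P ρ G₀ r loc M Z)
include hmodel

lemma measurableSet_size (m : ℕ) : MeasurableSet {s | M s = m} :=
  hmodel.measurable_size (measurableSet_singleton m)

lemma measurableSet_indicator_eq {m : ℕ} (k : Fin m → ℕ) :
    MeasurableSet {s | M s = m ∧ ∀ i : Fin m, Z i s = k i} := by
  refine (hmodel.measurableSet_size m).inter (?_ : MeasurableSet {s | ∀ i : Fin m, Z i s = k i})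
  rw [ofPred_forall]
  exact .iInter fun i => hmodel.measurable_indicator i (measurableSet_singleton (k i))

lemma measurable_loc_indicator (i : ℕ) : Measurable fun s => loc (Z i s) s :=
  (measurable_from_prod_countable_right (f := fun p : ℕ × S => loc p.1 p.2)
    hmodel.measurable_loc).comp ((hmodel.measurable_indicator i).prodMk measurable_id)

lemma atomSigmaAlgebra_le : atomSigmaAlgebra r loc ≤ ‹MeasurableSpace S› :=
  Measurable.comap_le (measurable_pi_lambda _ fun k =>
    (hmodel.measurable_weight k).prodMk (hmodel.measurable_loc k))

variable [IsFiniteMeasure P]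

lemma measureReal_indicator_eq_inter {m : ℕ} (k : Fin m → ℕ) {D : Set S}
    (hD : MeasurableSet[atomSigmaAlgebra r loc] D) :
    P.real ({s | M s = m ∧ ∀ i : Fin m, Z i s = k i} ∩ D) =
      ∫ s in D, (poissonMeasure (atomicMeasure r loc s univ).toNNReal).real {m} *
        ∏ i, (r (k i) s : ℝ) / (atomicMeasure r loc s univ).toReal ∂P := by
  have hE := hmodel.measurableSet_indicator_eq k
  rw [← integral_congr_ae (ae_restrict_of_ae (hmodel.sample m k)),
    setIntegral_condExp hmodel.atomSigmaAlgebra_le ((integrable_const 1).indicator hE) hD,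
    integral_indicator_const _ hE, measureReal_restrict_apply hE, smul_eq_mul, mul_one]

lemma measure_indicator_eq_inter {m : ℕ} (k : Fin m → ℕ) {D : Set S}
    (hD : MeasurableSet[atomSigmaAlgebra r loc] D) :
    P ({s | M s = m ∧ ∀ i : Fin m, Z i s = k i} ∩ D) =
      ∫⁻ s in D, ENNReal.ofReal ((m.factorial : ℝ)⁻¹ *
        Real.exp (-(atomicMeasure r loc s).real univ)) * ∏ i, (r (k i) s : ℝ≥0∞) ∂P := by
  rw [← ofReal_measureReal, hmodel.measureReal_indicator_eq_inter k hD,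
    ofReal_integral_eq_lintegral_ofReal
      (integrable_condExp.congr (hmodel.sample m k)).integrableOn
      (ae_of_all _ fun s => by positivity)]
  refine lintegral_congr_ae (ae_restrict_of_ae ?_)
  filter_upwards [hmodel.crm.finite] with s hs
  have hweight : ∀ i, r (k i) s ≤ (atomicMeasure r loc s univ).toNNReal := fun i =>
    ENNReal.le_toNNReal_of_coe_le (le_atomicMeasure_univ (k i) s) hs.ne
  rw [← ENNReal.coe_toNNReal_eq_toReal, poissonMeasure_mul_prod_div hweight,
    ENNReal.ofReal_mul (by positivity),
    ENNReal.ofReal_prod_of_nonneg fun i _ => NNReal.coe_nonneg _]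
  simp [Measure.real, ENNReal.coe_toNNReal_eq_toReal]

lemma ae_weight_ne_zero (m : ℕ) : ∀ᵐ s ∂P, M s = m → ∀ i : Fin m, r (Z i s) s ≠ 0 := by
  have hnull : ∀ (k : Fin m → ℕ) (i : Fin m),
      P ({s | M s = m ∧ ∀ i : Fin m, Z i s = k i} ∩ {s | r (k i) s = 0}) = 0 := by
    intro k i
    have hD : MeasurableSet[atomSigmaAlgebra r loc] {s | r (k i) s = 0} :=
      measurable_weight_atomSigmaAlgebra (k i) (measurableSet_singleton 0)
    rw [hmodel.measure_indicator_eq_inter k hD]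
    refine (setLIntegral_congr_fun (hmodel.atomSigmaAlgebra_le _ hD)
      fun s (hs : r (k i) s = 0) => ?_).trans lintegral_zero
    rw [Finset.prod_eq_zero (Finset.mem_univ i) (by simp [hs]), mul_zero]
  filter_upwards [ae_all_iff.2 fun k : Fin m → ℕ => ae_all_iff.2 fun i =>
    measure_eq_zero_iff_ae_notMem.1 (hnull k i)] with s hs hM i hi
  exact hs (fun i => Z i s) i ⟨⟨hM, fun _ => rfl⟩, hi⟩

lemma measure_loc_indicator_mem {m : ℕ} {A : Fin m → Set Ω} (hA : ∀ i, MeasurableSet (A i)) :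
    P {s | M s = m ∧ ∀ i : Fin m, loc (Z i s) s ∈ A i} =
      ∫⁻ s, ENNReal.ofReal ((m.factorial : ℝ)⁻¹ *
        Real.exp (-(atomicMeasure r loc s).real univ)) * ∏ i, atomicMeasure r loc s (A i) ∂P := by
  have hD : ∀ k : Fin m → ℕ,
      MeasurableSet[atomSigmaAlgebra r loc] {s | ∀ i, loc (k i) s ∈ A i} := fun k => by
    rw [ofPred_forall]
    exact .iInter fun i => measurable_loc_atomSigmaAlgebra (k i) (hA i)
  have hD' : ∀ k : Fin m → ℕ, MeasurableSet {s | ∀ i, loc (k i) s ∈ A i} := fun k =>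
    hmodel.atomSigmaAlgebra_le _ (hD k)
  have hunion : {s | M s = m ∧ ∀ i : Fin m, loc (Z i s) s ∈ A i} = ⋃ k : Fin m → ℕ,
      {s | M s = m ∧ ∀ i : Fin m, Z i s = k i} ∩ {s | ∀ i, loc (k i) s ∈ A i} := by
    ext s
    simp only [mem_ofPred_eq, mem_iUnion, mem_inter_iff]
    exact ⟨fun h => ⟨fun i => Z i s, ⟨h.1, fun _ => rfl⟩, h.2⟩,
      fun ⟨_, ⟨hM, hk⟩, h⟩ => ⟨hM, fun i => hk i ▸ h i⟩⟩
  have hdisj : Pairwise (Function.onFun Disjoint fun k : Fin m → ℕ =>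
      {s | M s = m ∧ ∀ i : Fin m, Z i s = k i} ∩ {s | ∀ i, loc (k i) s ∈ A i}) :=
    fun _ _ hkk' => disjoint_left.2 fun _ hs hs' =>
      hkk' (funext fun i => (hs.1.2 i).symm.trans (hs'.1.2 i))
  have htotal := hmodel.crm.measurable_real MeasurableSet.univ
  have hweight := hmodel.measurable_weight
  rw [hunion, measure_iUnion hdisj fun k => (hmodel.measurableSet_indicator_eq k).inter (hD' k)]
  simp only [hmodel.measure_indicator_eq_inter _ (hD _), ← lintegral_indicator (hD' _),
    indicator_mul_right]
  rw [← lintegral_tsum fun k => Measurable.aemeasurable (by fun_prop (disch := exact hD' k))]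
  simp only [ENNReal.tsum_mul_left, tsum_indicator_prod_eq_prod_atomicMeasure hA]

theorem measureReal_loc_indicator_mem {m : ℕ} {A : Fin m → Set Ω}
    (hA : ∀ i, MeasurableSet (A i)) :
    P.real {s | M s = m ∧ ∀ i : Fin m, loc (Z i s) s ∈ A i} =
      (m.factorial : ℝ)⁻¹ * ∫ s, Real.exp (-(atomicMeasure r loc s).real univ) *
        ∏ i, (atomicMeasure r loc s).real (A i) ∂P := by
  have htotal := hmodel.crm.measurable_real MeasurableSet.univ
  have hmass := fun i => hmodel.crm.measurable_real (hA i)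
  have hmeas : Measurable fun s => (m.factorial : ℝ)⁻¹ *
      (Real.exp (-(atomicMeasure r loc s).real univ) * ∏ i, (atomicMeasure r loc s).real (A i)) :=
    (htotal.neg.exp.mul (Finset.measurable_prod _ fun i _ => hmass i)).const_mul _
  rw [← integral_const_mul, integral_eq_lintegral_of_nonneg_ae
    (ae_of_all _ fun s => by positivity) hmeas.aestronglyMeasurable, measureReal_def,
    hmodel.measure_loc_indicator_mem hA]
  congr 1
  refine lintegral_congr_ae ?_
  filter_upwards [hmodel.crm.finite] with s hs
  have : IsFiniteMeasure (atomicMeasure r loc s) := ⟨hs⟩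
  rw [← mul_assoc, ENNReal.ofReal_mul (p := _ * _) (by positivity),
    ENNReal.ofReal_prod_of_nonneg fun i _ => measureReal_nonneg]
  simp only [ofReal_measureReal (measure_ne_top (atomicMeasure r loc s) _)]

end IsCountMixture

end Sample

section Ties

variable {S α β : Type*} {m l : ℕ}

lemma sameTies_iff_exists_embedding {x : Fin m → α} {z : Fin m → β}
    (hz : Function.Surjective z) : SameTies x z ↔ ∃ c : β ↪ α, ∀ i, x i = c (z i) := by
  refine ⟨fun h => ?_, fun ⟨c, hc⟩ a b => by rw [hc, hc, c.injective.eq_iff]⟩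
  have hsurj : ∀ j, z (Function.surjInv hz j) = j := Function.surjInv_eq hz
  refine ⟨⟨fun j => x (Function.surjInv hz j), fun j j' hjj' => ?_⟩, fun i => ?_⟩
  · simpa only [hsurj] using (h _ _).1 hjj'
  · exact (h _ _).2 (hsurj _).symm

lemma measurableSet_sameTies [MeasurableSpace S] [Countable α] [MeasurableSpace α]
    [MeasurableSingletonClass α] {x : Fin m → S → α} (hx : ∀ i, Measurable (x i)) (z : Fin m → β) :
    MeasurableSet {s | SameTies (fun i => x i s) z} :=
  measurable_pi_lambda (fun s i => x i s) hx
    (MeasurableSet.of_discrete (s := {y : Fin m → α | SameTies y z}))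

lemma clusterSize_ne_zero {z : Fin m → Fin l} (hz : Function.Surjective z) (j : Fin l) :
    clusterSize z j ≠ 0 := by
  obtain ⟨i, hi⟩ := hz j
  exact Finset.card_ne_zero.2 ⟨i, by simpa using hi⟩

lemma prod_comp_eq_prod_pow_clusterSize {R : Type*} [CommMonoid R] (z : Fin m → Fin l)
    (f : Fin l → R) : ∏ i, f (z i) = ∏ j, f j ^ clusterSize z j := by
  simp [← Finset.prod_fiberwise' Finset.univ z f, clusterSize]

end Ties

namespace IsCountMixture

variable {S Ω : Type*} [MeasurableSpace S] [MeasurableSpace Ω] {P : Measure S}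
  {ρ : Measure ℝ} {G₀ : Measure Ω} {r : ℕ → S → ℝ≥0} {loc : ℕ → S → Ω} {M : S → ℕ}
  {Z : ℕ → S → ℕ} {m l : ℕ} {z : Fin m → Fin l}

lemma measurableSet_size_inter_tiesEvent (hmodel : IsCountMixture P ρ G₀ r loc M Z) (n : ℕ)
    {α : Type*} (x : Fin m → α) : MeasurableSet ({s | M s = n} ∩ tiesEvent Z x) :=
  (hmodel.measurableSet_size n).inter
    (measurableSet_sameTies (fun i => hmodel.measurable_indicator i) x)

lemma tendsto_measureReal_sameTies_cell [IsFiniteMeasure P]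
    (hmodel : IsCountMixture P ρ G₀ r loc M Z) {β : Type*} (z : Fin m → β)
    {ι : ℕ → Type*} [∀ N, Countable (ι N)] [∀ N, MeasurableSpace (ι N)]
    [∀ N, MeasurableSingletonClass (ι N)] {φ : ∀ N, Ω → ι N}
    (hφ : IsSeparatingSequence φ) :
    Tendsto (fun N => P.real {s | M s = m ∧ SameTies (fun i : Fin m => φ N (loc (Z i s) s)) z})
      atTop (𝓝 (ecpf P M Z m z)) := by
  have hcell : ∀ N, MeasurableSet
      {s | M s = m ∧ SameTies (fun i : Fin m => φ N (loc (Z i s) s)) z} := fun N =>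
    (hmodel.measurableSet_size m).inter (measurableSet_sameTies
      (fun i => (hφ.measurable N).comp (hmodel.measurable_loc_indicator i)) z)
  refine (ENNReal.tendsto_toReal (measure_ne_top P _)).comp
    (tendsto_measure_of_ae_tendsto_indicator_of_isFiniteMeasure atTop
      (hmodel.measurableSet_size_inter_tiesEvent m z) hcell ?_)
  filter_upwards [hmodel.distinct_atoms, hmodel.ae_weight_ne_zero m] with s hdistinct hweight
  by_cases hM : M s = m
  · have hlabel : ∀ a b : Fin m, ∀ᶠ N in atTop,
        (φ N (loc (Z a s) s) = φ N (loc (Z b s) s) ↔ Z a s = Z b s) := fun a b => by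
      by_cases hab : Z a s = Z b s
      · exact Eventually.of_forall fun N => by simp [hab]
      · have hloc : loc (Z a s) s ≠ loc (Z b s) s := fun h =>
          hab (hdistinct _ _ (hweight hM a) (hweight hM b) h)
        filter_upwards [hφ.separates _ _ hloc] with N hN
        exact iff_of_false hN hab
    filter_upwards [eventually_all.2 fun a => eventually_all.2 (hlabel a)] with N hN
    simp only [mem_ofPred_eq, mem_inter_iff, tiesEvent, SameTies, hN]
  · exact Eventually.of_forall fun N => by simp [hM]

variable [IsProbabilityMeasure P]

lemma measureReal_sameTies_cell (hmodel : IsCountMixture P ρ G₀ r loc M Z)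
    (hz : Function.Surjective z) {ι : Type*} [Fintype ι] [MeasurableSpace ι]
    [MeasurableSingletonClass ι] {φ : Ω → ι} (hφ : Measurable φ) :
    P.real {s | M s = m ∧ SameTies (fun i : Fin m => φ (loc (Z i s) s)) z} =
      (m.factorial : ℝ)⁻¹ * (∫ s, Real.exp (-(atomicMeasure r loc s).real univ) ∂P) *
        ∑ c : Fin l ↪ ι, ∏ j, tiltedMoment P
          (fun s => (atomicMeasure r loc s).real (φ ⁻¹' {c j})) (clusterSize z j) := by
  classical
  have hcell : ∀ x, MeasurableSet (φ ⁻¹' {x}) := fun x => hφ (measurableSet_singleton x)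
  have hunion : {s | M s = m ∧ SameTies (fun i : Fin m => φ (loc (Z i s) s)) z} =
      ⋃ c : Fin l ↪ ι, {s | M s = m ∧ ∀ i : Fin m, loc (Z i s) s ∈ φ ⁻¹' {c (z i)}} := by
    ext s
    simp [sameTies_iff_exists_embedding hz]
  have hdisj : Pairwise (Function.onFun Disjoint fun c : Fin l ↪ ι =>
      {s | M s = m ∧ ∀ i : Fin m, loc (Z i s) s ∈ φ ⁻¹' {c (z i)}}) := fun c c' hcc' =>
    disjoint_left.2 fun s hs hs' => hcc' <| DFunLike.ext _ _ <| hz.forall.2 fun i =>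
      (hs.2 i).symm.trans (hs'.2 i)
  have hmeas : ∀ c : Fin l ↪ ι,
      MeasurableSet {s | M s = m ∧ ∀ i : Fin m, loc (Z i s) s ∈ φ ⁻¹' {c (z i)}} := fun c => by
    rw [ofPred_and, ofPred_forall]
    exact (hmodel.measurableSet_size m).inter
      (.iInter fun i => hmodel.measurable_loc_indicator i (hcell _))
  rw [hunion, measureReal_iUnion_fintype hdisj hmeas, Finset.mul_sum]
  refine Finset.sum_congr rfl fun c _ => ?_
  rw [hmodel.measureReal_loc_indicator_mem fun i => hcell _]
  have hprod : ∀ s, ∏ i, (atomicMeasure r loc s).real (φ ⁻¹' {c (z i)}) =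
      ∏ j, (atomicMeasure r loc s).real (φ ⁻¹' {c j}) ^ clusterSize z j := fun s =>
    prod_comp_eq_prod_pow_clusterSize z fun j => (atomicMeasure r loc s).real (φ ⁻¹' {c j})
  simp only [hprod]
  rw [hmodel.crm.integral_exp_neg_mul_prod_pow (fun j => hcell (c j))
    (fun j k hjk => Disjoint.preimage _ (by simpa using hjk)), mul_assoc]

theorem ecpf_eq_prod [MeasurableSpace.CountablySeparated Ω] [IsFiniteMeasure G₀]
    [NullSingletonClass G₀] (hρ : IntegrableOn (fun r => min 1 r) (Ioi 0) ρ)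
    (hmodel : IsCountMixture P ρ G₀ r loc M Z) (hz : Function.Surjective z) :
    ecpf P M Z m z =
      (m.factorial : ℝ)⁻¹ * (∫ s, Real.exp (-(atomicMeasure r loc s).real univ) ∂P) *
        ∏ j, G₀.real univ * kappa ρ (clusterSize z j) := by
  obtain ⟨φ, hφ⟩ := exists_isSeparatingSequence Ω
  refine tendsto_nhds_unique (hmodel.tendsto_measureReal_sameTies_cell z hφ) ?_
  simp only [fun N => hmodel.measureReal_sameTies_cell hz (hφ.measurable N)]
  exact (hφ.tendsto_sum_embedding_prod_tiltedMoment hρ hmodel.crm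
    (clusterSize_ne_zero hz)).const_mul _

end IsCountMixture

section AddElement

variable {S : Type*} {M : S → ℕ} {Z : ℕ → S → ℕ} {m l : ℕ} {z : Fin m → Fin l}

lemma mem_tiesEvent_addElement {k : Fin (l + 1)} {s : S} :
    s ∈ tiesEvent Z (addElement z k) ↔
      s ∈ tiesEvent Z z ∧ ∀ i : Fin m, Z m s = Z i s ↔ k = (z i).castSucc := by
  refine ⟨fun h => ⟨fun a b => ?_, fun i => ?_⟩, fun ⟨hold, hnew⟩ a b => ?_⟩
  · simpa [addElement] using h a.castSucc b.castSucc
  · simpa [addElement] using h (Fin.last m) i.castSucc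
  · cases a using Fin.lastCases with
    | last => cases b using Fin.lastCases with
      | last => simp
      | cast b => simpa [addElement] using hnew b
    | cast a => cases b using Fin.lastCases with
      | last => simpa [addElement, eq_comm] using hnew a
      | cast b => simpa [addElement] using hold a b

lemma tiesEvent_eq_iUnion_addElement (Z : ℕ → S → ℕ) (z : Fin m → Fin l) :
    tiesEvent Z z = ⋃ k, tiesEvent Z (addElement z k) := by
  ext s
  simp only [mem_iUnion, mem_tiesEvent_addElement]
  refine ⟨fun h => ?_, fun ⟨_, h, _⟩ => h⟩
  by_cases hjoin : ∃ i : Fin m, Z m s = Z i s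
  · obtain ⟨i, hi⟩ := hjoin
    refine ⟨(z i).castSucc, h, fun i' => ?_⟩
    rw [hi, Fin.castSucc_inj]
    exact h i i'
  · exact ⟨Fin.last l, h, fun i =>
      iff_of_false (not_exists.1 hjoin i) (Fin.castSucc_lt_last _).ne'⟩

lemma pairwise_disjoint_tiesEvent_addElement (hz : Function.Surjective z) :
    Pairwise (Function.onFun Disjoint fun k => tiesEvent Z (addElement z k)) := by
  refine fun k k' hkk' => disjoint_left.2 fun s hs hs' => hkk' ?_
  have hiff : ∀ j : Fin l, k = j.castSucc ↔ k' = j.castSucc := hz.forall.2 fun i =>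
    ((mem_tiesEvent_addElement.1 hs).2 i).symm.trans ((mem_tiesEvent_addElement.1 hs').2 i)
  cases k using Fin.lastCases with
  | cast j => exact ((hiff j).1 rfl).symm
  | last => cases k' using Fin.lastCases with
    | last => rfl
    | cast j => exact (hiff j).2 rfl

lemma tiesEvent_addElement_castSucc (Z : ℕ → S → ℕ) (z : Fin m → Fin l) (j : Fin l) :
    tiesEvent Z (addElement z j.castSucc) = tiesEvent Z (Fin.snoc (α := fun _ => Fin l) z j) := by
  have hlabel : addElement z j.castSucc =
      fun i => (Fin.snoc (α := fun _ => Fin l) z j i : Fin l).castSucc := by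
    ext i
    cases i using Fin.lastCases <;> simp [addElement]
  ext s
  simp [hlabel, tiesEvent, SameTies]

lemma surjective_addElement_last (hz : Function.Surjective z) :
    Function.Surjective (addElement z (Fin.last l)) := by
  intro k
  cases k using Fin.lastCases with
  | last => exact ⟨Fin.last m, by simp [addElement]⟩
  | cast j =>
    obtain ⟨i, rfl⟩ := hz j
    exact ⟨i.castSucc, by simp [addElement]⟩

lemma surjective_snoc (hz : Function.Surjective z) (j : Fin l) :
    Function.Surjective (Fin.snoc (α := fun _ => Fin l) z j) := by
  intro k
  obtain ⟨i, rfl⟩ := hz k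
  exact ⟨i.castSucc, by simp⟩

lemma clusterSize_snoc (z : Fin m → Fin l) (j : Fin l) :
    clusterSize (Fin.snoc (α := fun _ => Fin l) z j) =
      Function.update (clusterSize z) j (clusterSize z j + 1) := by
  ext k
  rw [clusterSize, Finset.card_filter, Fin.sum_univ_castSucc]
  simp only [Fin.snoc_castSucc, Fin.snoc_last, ← Finset.card_filter]
  rcases eq_or_ne k j with rfl | hkj
  · simp [clusterSize]
  · simp [clusterSize, hkj, hkj.symm]

lemma clusterSize_addElement_last (z : Fin m → Fin l) :
    clusterSize (addElement z (Fin.last l)) = Fin.snoc (α := fun _ => ℕ) (clusterSize z) 1 := by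
  ext k
  rw [addElement, clusterSize_snoc]
  cases k using Fin.lastCases with
  | last => simp [clusterSize, (Fin.castSucc_lt_last _).ne]
  | cast j => simp [clusterSize, (Fin.castSucc_lt_last j).ne]

lemma prod_mul_kappa_clusterSize_snoc {γ : ℝ} {ρ : Measure ℝ} (z : Fin m → Fin l) {j : Fin l}
    (hκ : kappa ρ (clusterSize z j) ≠ 0) :
    ∏ i, γ * kappa ρ (clusterSize (Fin.snoc (α := fun _ => Fin l) z j) i) =
      (∏ i, γ * kappa ρ (clusterSize z i)) *
        (kappa ρ (clusterSize z j + 1) / kappa ρ (clusterSize z j)) := by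
  have hupdate := Finset.prod_update_of_mem (Finset.mem_univ j)
    (fun i => γ * kappa ρ (clusterSize z i)) (γ * kappa ρ (clusterSize z j + 1))
  simp only [clusterSize_snoc, Function.apply_update fun _ n => γ * kappa ρ n, hupdate,
    Finset.prod_eq_mul_prod_sdiff_singleton_of_mem (Finset.mem_univ j)
      fun i => γ * kappa ρ (clusterSize z i)]
  field_simp

lemma predictionWeight_pos {γ : ℝ} (hγ : 0 < γ) {ρ : Measure ℝ}
    (hρ : IntegrableOn (fun r => min 1 r) (Ioi 0) ρ) (hρ0 : ρ (Ioi 0) ≠ 0)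
    (hz : Function.Surjective z) (k : Fin (l + 1)) : 0 < predictionWeight γ ρ z k := by
  cases k using Fin.lastCases with
  | last => simpa [predictionWeight] using mul_pos hγ (kappa_pos hρ hρ0 one_ne_zero)
  | cast j =>
    simpa [predictionWeight] using div_pos (kappa_pos hρ hρ0 (Nat.succ_ne_zero _))
      (kappa_pos hρ hρ0 (clusterSize_ne_zero hz j))

lemma ecpf_le_sizePMF [MeasurableSpace S] {P : Measure S} [IsFiniteMeasure P] (n : ℕ) {j : ℕ}
    {α : Type*} (x : Fin j → α) : ecpf P M Z n x ≤ sizePMF P M n :=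
  measureReal_mono inter_subset_left

end AddElement

namespace IsCountMixture

section Conditional

variable {S Ω : Type*} [MeasurableSpace S] [MeasurableSpace Ω] {P : Measure S} {ρ : Measure ℝ}
  {G₀ : Measure Ω} {r : ℕ → S → ℝ≥0} {loc : ℕ → S → Ω} {M : S → ℕ} {Z : ℕ → S → ℕ} {m l : ℕ}

lemma eppf_eq_div (hmodel : IsCountMixture P ρ G₀ r loc M Z) (n : ℕ) {α : Type*}
    (x : Fin m → α) : eppf P M Z n x = ecpf P M Z n x / sizePMF P M n := by
  simp [eppf, measureReal_def, cond_apply (hmodel.measurableSet_size n), sizePMF, ecpf,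
    div_eq_inv_mul]

lemma predictive_eq_div (hmodel : IsCountMixture P ρ G₀ r loc M Z) (z : Fin m → Fin l)
    (k : Fin (l + 1)) :
    predictive P M Z z k = ecpf P M Z (m + 1) (addElement z k) / ecpf P M Z (m + 1) z := by
  have hinter : {s | M s = m + 1} ∩ tiesEvent Z z ∩ tiesEvent Z (addElement z k) =
      {s | M s = m + 1} ∩ tiesEvent Z (addElement z k) := by
    rw [inter_assoc, inter_eq_right.2 fun s hs => (mem_tiesEvent_addElement.1 hs).1]
  simp [predictive, measureReal_def, cond_apply (hmodel.measurableSet_size_inter_tiesEvent _ z),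
    hinter, ecpf, div_eq_inv_mul]

lemma ecpf_eq_sum_addElement [IsFiniteMeasure P] (hmodel : IsCountMixture P ρ G₀ r loc M Z)
    (n : ℕ) {z : Fin m → Fin l} (hz : Function.Surjective z) :
    ecpf P M Z n z = ∑ k, ecpf P M Z n (addElement z k) := by
  simp only [ecpf]
  rw [tiesEvent_eq_iUnion_addElement, inter_iUnion, measureReal_iUnion_fintype
    (fun k k' hkk' => (pairwise_disjoint_tiesEvent_addElement hz hkk').mono
      inter_subset_right inter_subset_right)
    fun k => hmodel.measurableSet_size_inter_tiesEvent n _]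

end Conditional

section Prediction

variable {S Ω : Type*} [MeasurableSpace S] [MeasurableSpace Ω]
  [MeasurableSpace.CountablySeparated Ω] {P : Measure S} [IsProbabilityMeasure P] {ρ : Measure ℝ}
  {G₀ : Measure Ω} [IsFiniteMeasure G₀] [NullSingletonClass G₀] {r : ℕ → S → ℝ≥0}
  {loc : ℕ → S → Ω} {M : S → ℕ} {Z : ℕ → S → ℕ} {m l : ℕ} {z : Fin m → Fin l}

theorem ecpf_addElement (hρ : IntegrableOn (fun r => min 1 r) (Ioi 0) ρ) (hρ0 : ρ (Ioi 0) ≠ 0)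
    (hmodel : IsCountMixture P ρ G₀ r loc M Z) (hz : Function.Surjective z) (k : Fin (l + 1)) :
    ecpf P M Z (m + 1) (addElement z k) =
      ecpf P M Z m z / (m + 1) * predictionWeight (G₀.real univ) ρ z k := by
  have hfactorial : ((m + 1).factorial : ℝ)⁻¹ = (m.factorial : ℝ)⁻¹ / (m + 1) := by
    rw [Nat.factorial_succ, Nat.cast_mul, mul_inv, Nat.cast_succ, inv_mul_eq_div]
  rw [hmodel.ecpf_eq_prod hρ hz]
  cases k using Fin.lastCases with
  | last =>
    rw [hmodel.ecpf_eq_prod hρ (surjective_addElement_last hz), clusterSize_addElement_last,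
      Fin.prod_univ_castSucc, hfactorial]
    simp only [predictionWeight, Fin.snoc_castSucc, Fin.snoc_last]
    ring
  | cast j =>
    rw [ecpf, tiesEvent_addElement_castSucc, ← ecpf,
      hmodel.ecpf_eq_prod hρ (surjective_snoc hz j), hfactorial, prod_mul_kappa_clusterSize_snoc z
        (kappa_pos hρ hρ0 (clusterSize_ne_zero hz j)).ne', predictionWeight, Fin.snoc_castSucc]
    ring

theorem ecpf_succ (hρ : IntegrableOn (fun r => min 1 r) (Ioi 0) ρ) (hρ0 : ρ (Ioi 0) ≠ 0)
    (hmodel : IsCountMixture P ρ G₀ r loc M Z) (hz : Function.Surjective z) :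
    ecpf P M Z (m + 1) z =
      ecpf P M Z m z / (m + 1) * ∑ k, predictionWeight (G₀.real univ) ρ z k := by
  rw [hmodel.ecpf_eq_sum_addElement _ hz, Finset.mul_sum]
  exact Finset.sum_congr rfl fun k _ => hmodel.ecpf_addElement hρ hρ0 hz k

variable [NeZero G₀]

lemma ecpf_pos (hρ : IntegrableOn (fun r => min 1 r) (Ioi 0) ρ) (hρ0 : ρ (Ioi 0) ≠ 0)
    (hmodel : IsCountMixture P ρ G₀ r loc M Z) (hz : Function.Surjective z) :
    0 < ecpf P M Z m z := by
  rw [hmodel.ecpf_eq_prod hρ hz]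
  have hlaplace := hmodel.crm.integral_exp_neg_pos MeasurableSet.univ
  exact mul_pos (by positivity) (Finset.prod_pos fun j _ =>
    mul_pos measureReal_univ_pos (kappa_pos hρ hρ0 (clusterSize_ne_zero hz j)))

lemma ecpf_succ_pos (hρ : IntegrableOn (fun r => min 1 r) (Ioi 0) ρ) (hρ0 : ρ (Ioi 0) ≠ 0)
    (hmodel : IsCountMixture P ρ G₀ r loc M Z) (hz : Function.Surjective z) :
    0 < ecpf P M Z (m + 1) z := by
  rw [hmodel.ecpf_succ hρ hρ0 hz]
  exact mul_pos (div_pos (hmodel.ecpf_pos hρ hρ0 hz) (by positivity)) <| Finset.sum_pos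
    (fun k _ => predictionWeight_pos measureReal_univ_pos hρ hρ0 hz k) Finset.univ_nonempty

theorem eppf_succ (hρ : IntegrableOn (fun r => min 1 r) (Ioi 0) ρ) (hρ0 : ρ (Ioi 0) ≠ 0)
    (hmodel : IsCountMixture P ρ G₀ r loc M Z) (hz : Function.Surjective z) :
    eppf P M Z (m + 1) z =
      eppf P M Z m z * (sizePMF P M m / ((m + 1 : ℝ) * sizePMF P M (m + 1))) *
        (G₀.real univ * kappa ρ 1 +
          ∑ k, kappa ρ (clusterSize z k + 1) / kappa ρ (clusterSize z k)) := by
  have hsize : sizePMF P M m ≠ 0 :=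
    ((hmodel.ecpf_pos hρ hρ0 hz).trans_le (ecpf_le_sizePMF m z)).ne'
  rw [hmodel.eppf_eq_div, hmodel.eppf_eq_div, hmodel.ecpf_succ hρ hρ0 hz, Fin.sum_univ_castSucc]
  simp only [predictionWeight, Fin.snoc_castSucc, Fin.snoc_last]
  field_simp
  ring

theorem predictive_eq_predictionWeight_div (hρ : IntegrableOn (fun r => min 1 r) (Ioi 0) ρ)
    (hρ0 : ρ (Ioi 0) ≠ 0) (hmodel : IsCountMixture P ρ G₀ r loc M Z)
    (hz : Function.Surjective z) (k : Fin (l + 1)) :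
    predictive P M Z z k = predictionWeight (G₀.real univ) ρ z k /
      ∑ k', predictionWeight (G₀.real univ) ρ z k' := by
  have hfactor : ecpf P M Z m z / (m + 1) ≠ 0 :=
    (div_pos (hmodel.ecpf_pos hρ hρ0 hz) (by positivity)).ne'
  rw [hmodel.predictive_eq_div, hmodel.ecpf_addElement hρ hρ0 hz, hmodel.ecpf_succ hρ hρ0 hz,
    mul_div_mul_left _ _ hfactor]

end Prediction

end IsCountMixture

end

end CountMixture

theorem mainTheorem5 {S Ω : Type*} [MeasurableSpace S] [MeasurableSpace Ω]
    [MeasurableSpace.CountablySeparated Ω]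
    (P : Measure S) [IsProbabilityMeasure P]
    (ρ : Measure ℝ) (hρ : ∫⁻ r in Ioi (0 : ℝ), ENNReal.ofReal (min 1 r) ∂ρ < ∞)
    (hρ0 : ρ (Ioi 0) ≠ 0)
    (G₀ : Measure Ω) [IsFiniteMeasure G₀] [NullSingletonClass G₀] (hG₀ : G₀ ≠ 0)
    (r : ℕ → S → ℝ≥0) (loc : ℕ → S → Ω) (M : S → ℕ) (Z : ℕ → S → ℕ)
    (hmodel : IsCountMixture P ρ G₀ r loc M Z)
    (m l : ℕ) (z : Fin m → Fin l) (hz : Function.Surjective z) :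
    (∀ n : ℕ, 1 ≤ n → 0 < kappa ρ n) ∧
    0 < sizePMF P M m ∧ 0 < sizePMF P M (m + 1) ∧ 0 < ecpf P M Z (m + 1) z ∧
    eppf P M Z (m + 1) z =
      eppf P M Z m z * (sizePMF P M m / ((m + 1 : ℝ) * sizePMF P M (m + 1))) *
        (G₀.real univ * kappa ρ 1 +
          ∑ k, kappa ρ (clusterSize z k + 1) / kappa ρ (clusterSize z k)) ∧
    ∀ k : Fin (l + 1),
      predictive P M Z z k =
        ecpf P M Z (m + 1) (addElement z k) / ecpf P M Z (m + 1) z ∧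
      predictive P M Z z k =
        predictionWeight (G₀.real univ) ρ z k /
          ∑ k', predictionWeight (G₀.real univ) ρ z k' := by
  have hρ' := integrableOn_min_one_of_lintegral_lt_top hρ
  have : NeZero G₀ := ⟨hG₀⟩
  have hecpf : 0 < ecpf P M Z m z := hmodel.ecpf_pos hρ' hρ0 hz
  have hecpf_succ : 0 < ecpf P M Z (m + 1) z := hmodel.ecpf_succ_pos hρ' hρ0 hz
  exact ⟨fun n hn => kappa_pos hρ' hρ0 (Nat.one_le_iff_ne_zero.1 hn),
    hecpf.trans_le (ecpf_le_sizePMF m z), hecpf_succ.trans_le (ecpf_le_sizePMF (m + 1) z),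
    hecpf_succ, hmodel.eppf_succ hρ' hρ0 hz, fun k => ⟨hmodel.predictive_eq_div z k,
      hmodel.predictive_eq_predictionWeight_div hρ' hρ0 hz k⟩⟩
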